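/- Let $f\in\mathbb{Z}[X]$ be a monic irreducible polynomial of degree $d\geq 2$ which is even, in the sense that $f(-X)=f(X)$. For a positive integer $N$, let $L_f(N)=\operatorname{lcm}\{f(1),\ldots,f(N)\}$ denote the positive least common multiple of the (non-zero) integers $f(1),\ldots,f(N)$. Then there is a constant $C$, depending only on $f$, such that for every integer $N\geq 1$ $$\log L_f(N)\;\geq\;\frac{2(d-1)}{d}\,N\log N - C\,N.$$ -/

import Mathlib

/-- `polyLcm f N` is the (nonnegative) least common multiple `L_f(N)` of the values
`f(1), …, f(N)` of an integer polynomial `f`. -/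
def polyLcm (f : Polynomial ℤ) (N : ℕ) : ℤ :=
  (Finset.Icc 1 N).lcm fun n : ℕ => f.eval (n : ℤ)

/-! ### Lattice points of an ideal in a coordinate box -/

section NormBox

open Module

variable {R : Type*} [CommRing R] [IsDomain R] {ι : Type*} [Fintype ι]

/-! Compare two evaluations of log|f(1)⋯f(N)|. Its size is d N log N + O(N), since |f(n)| ≫ n^d.
Factor the product and split the primes at 2N.

A prime p > 2N divides at most d/2 of the values: the integers ±1, …, ±N are incongruent mod p,
evenness makes their roots come in pairs, and f has at most d roots mod p
(`two_mul_dvdCount_le_natDegree`). Hence these primes contribute at most (d/2) log L. The primes p ≤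
2N contribute at most N log N + O(N) (`exists_sum_prodExponent_mul_log_le`). Subtracting, (d/2) log
L ≥ (d-1) N log N - O(N).

The small primes need the upper half of a Mertens theorem, ∑_{p ≤ x} ρ(p) log p / p ≤ log x + O(1),
with ρ(p) the number of roots mod p (`exists_sum_rootCount_mul_log_div_le`). It is proved by
elementary counting in R = ℤ[X]/(f). Roots mod p give ideals of index p. An element a ≠ 0 of a box
of side M lies in ideals whose indices multiply to at most |N(a)| ≪ M^d, while an ideal of index q
contains about M^d/q elements of the box. Double counting with M^d ≍ x gives the bound. -/

theorem natCard_quotient_span_singleton (b : Basis ι ℤ R) {a : R} (ha : a ≠ 0) :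
    Nat.card (R ⧸ Ideal.span {a}) = (Algebra.norm ℤ a).natAbs := by
  have : Module.Free ℤ R := Module.Free.of_basis b
  have : Module.Finite ℤ R := Module.Finite.of_basis b
  have hinj : Function.Injective (LinearMap.mulLeft ℤ a) := fun x y h => mul_left_cancel₀ ha h
  have h := Submodule.natAbs_det_equiv (LinearMap.range (LinearMap.mulLeft ℤ a))
    (LinearEquiv.ofInjective _ hinj)
  have h2 : (LinearMap.range (LinearMap.mulLeft ℤ a)).subtype ∘ₗ
      ((LinearEquiv.ofInjective _ hinj : R ≃ₗ[ℤ] _) : R →+ _).toIntLinearMap =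
      LinearMap.mulLeft ℤ a := by
    ext x; rfl
  rw [Algebra.norm_apply]
  have h3 : LinearMap.range (LinearMap.mulLeft ℤ a) =
      (Ideal.span {a}).restrictScalars ℤ := by
    ext x
    simp [Ideal.mem_span_singleton', mul_comm]
  have h4 : Nat.card (R ⧸ LinearMap.range (LinearMap.mulLeft ℤ a)) =
      Nat.card (R ⧸ Ideal.span {a}) := by
    rw [h3]
    rfl
  rw [← h4, ← h]
  congr 2

theorem dvd_natAbs_norm (b : Basis ι ℤ R) {a : R} (ha : a ≠ 0) :
    a ∣ (((Algebra.norm ℤ a).natAbs : ℕ) : R) := by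
  rw [← natCard_quotient_span_singleton b ha, ← Ideal.mem_span_singleton,
    ← Ideal.Quotient.eq_zero_iff_mem, map_natCast, ← nsmul_one]
  exact card_nsmul_eq_zero'

/-- By the Chinese remainder theorem the product is the index of the intersection of the P, which
contains (a). -/
theorem prod_natCard_quotient_dvd_norm (b : Basis ι ℤ R) {a : R} (ha : a ≠ 0)
    (S : Finset (Ideal R)) (hS : ∀ P ∈ S, P.IsMaximal) (haS : ∀ P ∈ S, a ∈ P) :
    ∏ P ∈ S, Nat.card (R ⧸ P) ∣ (Algebra.norm ℤ a).natAbs := by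
  rw [← natCard_quotient_span_singleton b ha, ← Finset.prod_coe_sort, ← Nat.card_pi]
  let e := Ideal.quotientInfRingEquivPiQuotient (fun P : S => (P : Ideal R)) (by
    intro P Q hPQ
    have := hS P P.2
    have := hS Q Q.2
    exact Ideal.isCoprime_of_isMaximal (fun h => hPQ (Subtype.ext h)))
  rw [← Nat.card_congr e.toEquiv]
  have hle : Ideal.span {a} ≤ ⨅ P : S, (P : Ideal R) := by
    rw [Ideal.span_singleton_le_iff_mem, Ideal.mem_iInf]
    exact fun P => haS P P.2
  exact AddSubgroup.card_dvd_of_surjective (Ideal.Quotient.factor hle).toAddMonoidHom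
    (Ideal.Quotient.factor_surjective hle)

/-- All coordinates of `x` with respect to the basis `b` are at most `A` in absolute value. -/
def CoordLE (b : Basis ι ℤ R) (A : ℤ) (x : R) : Prop := ∀ i, |b.repr x i| ≤ A

omit [IsDomain R] in
theorem exists_coordLE_mul (b : Basis ι ℤ R) : ∃ C : ℕ, 0 < C ∧ ∀ A B : ℤ, ∀ x y : R,
    CoordLE b A x → CoordLE b B y → CoordLE b (C * (A * B)) (x * y) := by
  refine ⟨∑ k, ∑ i, ∑ j, (b.repr (b i * b j) k).natAbs + 1, by positivity, ?_⟩
  intro A B x y hx hy k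
  have hxy : b.repr (x * y) k = ∑ i, ∑ j, b.repr x i * b.repr y j * b.repr (b i * b j) k := by
    conv_lhs => rw [← b.sum_repr x, ← b.sum_repr y, Finset.sum_mul_sum]
    simp only [map_sum, Finsupp.finsetSum_apply, smul_mul_smul_comm, map_smul, Finsupp.smul_apply,
      smul_eq_mul]
  have hA : 0 ≤ A := (abs_nonneg _).trans (hx k)
  have hB : 0 ≤ B := (abs_nonneg _).trans (hy k)
  rw [hxy]
  calc |∑ i, ∑ j, b.repr x i * b.repr y j * b.repr (b i * b j) k|
      ≤ ∑ i, ∑ j, A * B * |b.repr (b i * b j) k| := by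
        refine (Finset.abs_sum_le_sum_abs _ _).trans (Finset.sum_le_sum fun i _ => ?_)
        refine (Finset.abs_sum_le_sum_abs _ _).trans (Finset.sum_le_sum fun j _ => ?_)
        rw [abs_mul, abs_mul]
        gcongr
        · exact hx i
        · exact hy j
    _ = (∑ i, ∑ j, |b.repr (b i * b j) k|) * (A * B) := by
        simp only [← Finset.mul_sum]; ring
    _ ≤ _ := by
        refine mul_le_mul_of_nonneg_right ?_ (by positivity)
        push_cast
        have := Finset.single_le_sum (f := fun k => ∑ i, ∑ j, |b.repr (b i * b j) k|)
          (fun k _ => by positivity) (Finset.mem_univ k)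
        exact this.trans (by simp)

omit [IsDomain R] in
theorem exists_abs_norm_le (b : Basis ι ℤ R) : ∃ C : ℕ, 0 < C ∧ ∀ A : ℤ, ∀ x : R,
    CoordLE b A x → |Algebra.norm ℤ x| ≤ C * A ^ Fintype.card ι := by
  obtain ⟨C, hC, hmul⟩ := exists_coordLE_mul b
  refine ⟨(Fintype.card ι).factorial * C ^ Fintype.card ι, by positivity, ?_⟩
  intro A x hx
  classical
  rw [Algebra.norm_eq_matrix_det b]
  have h := Matrix.det_le (A := Algebra.leftMulMatrix b x) (abv := AbsoluteValue.abs)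
    (x := (C * (A * 1) : ℤ)) (fun i j => by
      rw [Algebra.leftMulMatrix_eq_repr_mul]
      refine hmul A 1 x (b j) hx (fun k => ?_) i
      rw [b.repr_self, Finsupp.single_apply]
      split_ifs <;> simp)
  refine h.trans (le_of_eq ?_)
  push_cast
  simp only [nsmul_eq_mul]
  ring

omit [IsDomain R] in
theorem repr_equivFun_symm (b : Basis ι ℤ R) (c : ι → ℤ) (i : ι) :
    b.repr (b.equivFun.symm c) i = c i := by
  rw [← b.equivFun_apply, LinearEquiv.apply_symm_apply]

open Classical in
/-- The elements of `R` all of whose coordinates are at most `B` in absolute value. -/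
noncomputable def coordBox (b : Basis ι ℤ R) (B : ℕ) : Finset R :=
  (Fintype.piFinset fun _ : ι => Finset.Icc (-B : ℤ) B).image b.equivFun.symm

omit [IsDomain R] in
theorem mem_coordBox {b : Basis ι ℤ R} {B : ℕ} {x : R} : x ∈ coordBox b B ↔ CoordLE b B x := by
  simp only [coordBox, Finset.mem_image, Fintype.mem_piFinset, Finset.mem_Icc, CoordLE, abs_le]
  constructor
  · rintro ⟨c, hc, rfl⟩ i
    rw [repr_equivFun_symm]
    exact hc i
  · intro h
    exact ⟨b.equivFun x, h, b.equivFun.symm_apply_apply x⟩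

omit [IsDomain R] in
theorem card_coordBox (b : Basis ι ℤ R) (B : ℕ) :
    (coordBox b B).card = (2 * B + 1) ^ Fintype.card ι := by
  classical
  rw [coordBox, Finset.card_image_of_injective _ b.equivFun.symm.injective]
  simp only [Fintype.card_piFinset, Int.card_Icc, Finset.prod_const, Finset.card_univ]
  congr 1
  omega

omit [IsDomain R] in
/-- Pigeonhole: an ideal of small index contains a short nonzero vector. -/
theorem exists_short_mem (b : Basis ι ℤ R) (P : Ideal R) (hP : Nat.card (R ⧸ P) ≠ 0) (T : ℕ)
    (hT : Nat.card (R ⧸ P) < (2 * T + 1) ^ Fintype.card ι) :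
    ∃ v ∈ P, v ≠ 0 ∧ CoordLE b (2 * T) v := by
  have : Finite (R ⧸ P) := Nat.finite_of_card_ne_zero hP
  have := Fintype.ofFinite (R ⧸ P)
  obtain ⟨x, hx, y, hy, hxy, he⟩ := Finset.exists_ne_map_eq_of_card_lt_of_maps_to
    (s := coordBox b T) (t := Finset.univ) (f := Ideal.Quotient.mk P)
    (by rwa [card_coordBox, Finset.card_univ, ← Nat.card_eq_fintype_card])
    (fun _ _ => Finset.mem_coe.2 (Finset.mem_univ _))
  refine ⟨x - y, Ideal.Quotient.eq.1 he, sub_ne_zero.2 hxy, fun i => ?_⟩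
  rw [map_sub, Finsupp.sub_apply]
  have h1 := mem_coordBox.1 hx i
  have h2 := mem_coordBox.1 hy i
  exact (abs_sub _ _).trans (by linarith)

/-- Pigeonhole gives a short v ≠ 0 in P. Rounding the coordinates of z/v and multiplying back by v
changes z by an element of P. What remains is v times an element with bounded coordinates, so it has
size O(T). To stay in R, z/v is written v'z/n with vv' = n = |N(v)|. -/
theorem exists_short_representative (b : Basis ι ℤ R) : ∃ C : ℕ, 0 < C ∧ ∀ P : Ideal R,
    Nat.card (R ⧸ P) ≠ 0 → ∀ T : ℕ, Nat.card (R ⧸ P) < (2 * T + 1) ^ Fintype.card ι →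
    ∀ z : R, ∃ w, z - w ∈ P ∧ CoordLE b (C * T : ℕ) w := by
  obtain ⟨C, hC, hmul⟩ := exists_coordLE_mul b
  refine ⟨2 * C, by positivity, ?_⟩
  intro P hP T hT z
  obtain ⟨v, hvP, hv0, hv⟩ := exists_short_mem b P hP T hT
  obtain ⟨v', hv'⟩ := dvd_natAbs_norm b hv0
  have hn0 : (Algebra.norm ℤ v).natAbs ≠ 0 := by
    rw [Int.natAbs_ne_zero, Algebra.norm_ne_zero_iff_of_basis b]; exact hv0
  set n : ℕ := (Algebra.norm ℤ v).natAbs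
  set q : R := b.equivFun.symm fun i => b.repr (v' * z) i / n
  set s : R := b.equivFun.symm fun i => b.repr (v' * z) i % n
  have hqs : v' * z = (n : R) * q + s := by
    apply b.repr.injective
    ext i
    rw [← nsmul_eq_mul, map_add, map_nsmul, Finsupp.add_apply, Finsupp.smul_apply,
      repr_equivFun_symm, repr_equivFun_symm, nsmul_eq_mul]
    exact (Int.mul_ediv_add_emod _ _).symm
  have hs : CoordLE b n s := fun i => by
    rw [repr_equivFun_symm, abs_of_nonneg (Int.emod_nonneg _ (by exact_mod_cast hn0))]
    exact (Int.emod_lt_of_pos _ (by positivity)).le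
  refine ⟨z - v * q, by simpa using P.mul_mem_right q hvP, fun i => ?_⟩
  have hnz : n • (z - v * q) = v * s := by
    rw [nsmul_eq_mul]
    linear_combination z * hv' + v * hqs
  have h1 := hmul _ _ v s hv hs i
  rw [← hnz, map_nsmul, Finsupp.smul_apply, nsmul_eq_mul, abs_mul, abs_of_nonneg (by positivity)]
    at h1
  have hnpos : (0 : ℤ) < n := by positivity
  refine le_of_mul_le_mul_left (h1.trans (le_of_eq ?_)) hnpos
  push_cast
  ring

/-- Subtracting from each z in the box of radius B - CT the short representative of its class gives
a point of P in the box of radius B. That point and the class determine z. -/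
theorem exists_card_ideal_inter_box (b : Basis ι ℤ R) : ∃ C : ℕ, 0 < C ∧ ∀ P : Ideal R,
    Nat.card (R ⧸ P) ≠ 0 → ∀ T : ℕ, Nat.card (R ⧸ P) < (2 * T + 1) ^ Fintype.card ι →
    ∀ B : ℕ, ∀ s : Finset R, (∀ x, x ∈ P → x ∈ coordBox b B → x ∈ s) → C * T ≤ B →
    (2 * (B - C * T) + 1) ^ Fintype.card ι ≤ Nat.card (R ⧸ P) * s.card := by
  obtain ⟨C, hC, hrep⟩ := exists_short_representative b
  refine ⟨C, hC, ?_⟩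
  intro P hP T hT B s hs hB
  have : Finite (R ⧸ P) := Nat.finite_of_card_ne_zero hP
  have := Fintype.ofFinite (R ⧸ P)
  have hrep' : ∀ c : R ⧸ P, ∃ w, Ideal.Quotient.mk P w = c ∧ CoordLE b (C * T : ℕ) w := by
    intro c
    obtain ⟨z, rfl⟩ := Ideal.Quotient.mk_surjective c
    obtain ⟨w, hw, hw'⟩ := hrep P hP T hT z
    exact ⟨w, (Ideal.Quotient.eq.2 hw).symm, hw'⟩
  choose w hw hw' using hrep'
  rw [← card_coordBox b, Nat.card_eq_fintype_card, ← Finset.card_univ, ← Finset.card_product]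
  refine Finset.card_le_card_of_injOn
    (fun z => (Ideal.Quotient.mk P z, z - w (Ideal.Quotient.mk P z))) ?_ ?_
  · intro z hz
    rw [Finset.mem_coe, Finset.mem_product]
    refine ⟨Finset.mem_univ _, hs _ (Ideal.Quotient.eq.1 (hw _).symm) (mem_coordBox.2 fun i => ?_)⟩
    have h1 := mem_coordBox.1 hz i
    have h2 := hw' (Ideal.Quotient.mk P z) i
    rw [map_sub, Finsupp.sub_apply]
    refine (abs_sub _ _).trans ((add_le_add h1 h2).trans (le_of_eq ?_))
    push_cast [hB]
    ring
  · intro z _ z' _ h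
    simp only [Prod.mk.injEq] at h
    have h2 := h.2
    rw [h.1] at h2
    exact sub_left_injective h2

end NormBox

/-! ### Double counting of elements and ideals -/

section LogSum

open Module

variable {R : Type*} [CommRing R] [IsDomain R] {ι : Type*} [Fintype ι] [Nonempty ι]

open Classical in
-- T is taken just above q^(1/d), as the pigeonhole allows. The saving q^(1/d)/q in the error
-- matters: summed against log p over p ≤ M^d it costs O(M), so the total error is O(M^d).
theorem exists_card_ideal_inter_box_real (b : Basis ι ℤ R) : ∃ C : ℝ, 0 ≤ C ∧ ∀ P : Ideal R,
    Nat.card (R ⧸ P) ≠ 0 → ∀ B : ℕ,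
    (2 * B + 1 : ℝ) ^ Fintype.card ι / Nat.card (R ⧸ P) -
      C * (2 * B + 1 : ℝ) ^ (Fintype.card ι - 1) *
        ((Nat.card (R ⧸ P) : ℝ) ^ (1 / (Fintype.card ι : ℝ)) / Nat.card (R ⧸ P))
      ≤ ((coordBox b B).filter (· ∈ P)).card := by
  obtain ⟨C, hC, hcount⟩ := exists_card_ideal_inter_box b
  have hd : 0 < Fintype.card ι := Fintype.card_pos
  refine ⟨4 * Fintype.card ι * C, by positivity, ?_⟩
  intro P hP B
  have hcount := hcount P hP
  set d := Fintype.card ι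
  set q := Nat.card (R ⧸ P)
  set r : ℝ := (q : ℝ) ^ (1 / (d : ℝ)) with hr
  set T : ℕ := ⌊r⌋₊ + 1 with hTdef
  have hq1 : (1 : ℝ) ≤ q := by exact_mod_cast Nat.one_le_iff_ne_zero.2 hP
  have hr1 : 1 ≤ r := Real.one_le_rpow hq1 (by positivity)
  have hT1 : r < T := by rw [hTdef]; push_cast; exact Nat.lt_floor_add_one r
  have hT2 : (T : ℝ) ≤ 2 * r := by
    rw [hTdef]; push_cast; linarith [Nat.floor_le (zero_le_one.trans hr1)]
  have hrd : r ^ d = q := by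
    rw [hr, one_div, Real.rpow_inv_natCast_pow (by positivity) hd.ne']
  have hqT : q < (2 * T + 1) ^ d := by
    have : (q : ℝ) < (2 * T + 1 : ℝ) ^ d := by
      rw [← hrd]
      exact pow_lt_pow_left₀ (by linarith) (by positivity) hd.ne'
    exact_mod_cast this
  have hcount := hcount T hqT B ((coordBox b B).filter (· ∈ P))
    (fun x hx hx' => Finset.mem_filter.2 ⟨hx', hx⟩)
  set s := (coordBox b B).filter (· ∈ P)
  set M : ℝ := 2 * B + 1 with hM
  have hM0 : 0 < M := by positivity
  have hMd : M ^ d = M * M ^ (d - 1) := by rw [mul_comm, pow_sub_one_mul hd.ne']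
  have key : M ^ d - 2 * d * C * T * M ^ (d - 1) ≤ q * s.card := by
    by_cases hB : C * T ≤ B
    · have h1 : ((2 * (B - C * T : ℕ) + 1 : ℝ)) ^ d ≤ q * s.card := by exact_mod_cast hcount hB
      refine le_trans ?_ h1
      have h2 : (2 * (B - C * T : ℕ) + 1 : ℝ) = M * (1 + -(2 * C * T / M)) := by
        push_cast [hB]
        field_simp
        rw [hM]; ring
      have hB' : (C * T : ℝ) ≤ B := by exact_mod_cast hB
      rw [h2, mul_pow]
      have h3 := one_add_mul_le_pow (a := -(2 * C * T / M)) (by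
        rw [neg_le_neg_iff, div_le_iff₀ hM0]
        linarith) d
      refine le_trans (le_of_eq ?_) (mul_le_mul_of_nonneg_left h3 (by positivity))
      rw [hMd]
      field_simp
      ring
    -- The box is too small for the count, but then the left side is not positive.
    · have hB' : (B + 1 : ℝ) ≤ C * T := by exact_mod_cast Nat.lt_of_not_le hB
      have hd1 : (1 : ℝ) ≤ d := by exact_mod_cast hd
      have : M ≤ 2 * d * C * T := by
        calc M ≤ 1 * (2 * (C * T)) := by linarith
          _ ≤ d * (2 * (C * T)) := by gcongr
          _ = _ := by ring
      have h4 : M ^ d ≤ 2 * d * C * T * M ^ (d - 1) := by rw [hMd]; gcongr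
      have : (0 : ℝ) ≤ q * s.card := by positivity
      linarith
  have hq0 : (0 : ℝ) < q := by linarith
  have h5 : 2 * d * C * T * M ^ (d - 1) ≤ 4 * d * C * M ^ (d - 1) * r := by
    calc 2 * d * C * T * M ^ (d - 1) = 2 * d * C * M ^ (d - 1) * T := by ring
      _ ≤ 2 * d * C * M ^ (d - 1) * (2 * r) := by gcongr
      _ = _ := by ring
  rw [← mul_div_assoc, ← sub_div, div_le_iff₀ hq0, mul_comm (s.card : ℝ)]
  linarith

/-- Count pairs a ∈ P with a ≠ 0 in the box, weighted by the log of the index of P. For fixed a the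
weights add up to at most log|N(a)|; for fixed P the box count applies. The unscaled sum of logs on
the right pays for a = 0, which lies in every P. -/
theorem exists_sum_log_div_le (b : Basis ι ℤ R) : ∃ C : ℝ, 0 ≤ C ∧ ∀ S : Finset (Ideal R),
    (∀ P ∈ S, P.IsMaximal) → (∀ P ∈ S, Nat.card (R ⧸ P) ≠ 0) → ∀ B : ℕ,
    (2 * B + 1 : ℝ) ^ Fintype.card ι *
        ∑ P ∈ S, Real.log (Nat.card (R ⧸ P)) / Nat.card (R ⧸ P) ≤
      (2 * B + 1 : ℝ) ^ Fintype.card ι * (Fintype.card ι * Real.log (2 * B + 1) + C) +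
      ∑ P ∈ S, Real.log (Nat.card (R ⧸ P)) +
      C * (2 * B + 1 : ℝ) ^ (Fintype.card ι - 1) * ∑ P ∈ S, Real.log (Nat.card (R ⧸ P)) *
        ((Nat.card (R ⧸ P) : ℝ) ^ (1 / (Fintype.card ι : ℝ)) / Nat.card (R ⧸ P)) := by
  classical
  obtain ⟨C₁, hC₁, hcount⟩ := exists_card_ideal_inter_box_real b
  obtain ⟨C₂, hC₂, hnorm⟩ := exists_abs_norm_le b
  refine ⟨max C₁ (Real.log C₂), hC₁.trans (le_max_left _ _), ?_⟩
  intro S hS hcard B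
  set d := Fintype.card ι
  set M : ℝ := 2 * B + 1 with hM
  have hM1 : 1 ≤ M := by rw [hM]; linarith [(Nat.cast_nonneg B : (0 : ℝ) ≤ B)]
  have hlogq : ∀ P ∈ S, 0 ≤ Real.log (Nat.card (R ⧸ P)) := fun P _ => Real.log_natCast_nonneg _
  set box := (coordBox b B).erase 0
  have hC₂' : 0 ≤ Real.log C₂ := Real.log_natCast_nonneg _
  have upper : ∀ a ∈ box, ∑ P ∈ S with a ∈ P, Real.log (Nat.card (R ⧸ P)) ≤
      d * Real.log M + Real.log C₂ := by
    intro a ha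
    obtain ⟨ha0, ha⟩ := Finset.mem_erase.1 ha
    have hdvd := prod_natCard_quotient_dvd_norm b ha0 (S.filter (a ∈ ·))
      (fun P hP => hS P (Finset.mem_filter.1 hP).1) (fun P hP => (Finset.mem_filter.1 hP).2)
    have hn0 : (Algebra.norm ℤ a).natAbs ≠ 0 := by
      rw [Int.natAbs_ne_zero, Algebra.norm_ne_zero_iff_of_basis b]; exact ha0
    have hle := Nat.le_of_dvd (Nat.pos_of_ne_zero hn0) hdvd
    rw [← Real.log_prod (fun P hP => Nat.cast_ne_zero.2 (hcard P (Finset.mem_filter.1 hP).1))]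
    have h1 : (∏ P ∈ S with a ∈ P, (Nat.card (R ⧸ P) : ℝ)) ≤ C₂ * M ^ d := by
      have h2 := hnorm B a (mem_coordBox.1 ha)
      have h3 : ((∏ P ∈ S with a ∈ P, Nat.card (R ⧸ P) : ℕ) : ℤ) ≤ C₂ * (B : ℤ) ^ d := by
        refine le_trans ?_ h2
        rw [Int.abs_eq_natAbs]
        exact_mod_cast hle
      have h4 : (∏ P ∈ S with a ∈ P, (Nat.card (R ⧸ P) : ℝ)) ≤ C₂ * (B : ℝ) ^ d := by
        exact_mod_cast h3
      refine h4.trans ?_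
      gcongr
      rw [hM]; linarith [(Nat.cast_nonneg B : (0 : ℝ) ≤ B)]
    refine (Real.log_le_log ?_ h1).trans ?_
    · exact Finset.prod_pos fun P hP =>
        Nat.cast_pos.2 (Nat.pos_of_ne_zero (hcard P (Finset.mem_filter.1 hP).1))
    · rw [Real.log_mul (by positivity) (by positivity), Real.log_pow]
      linarith
  have htotal : ∑ P ∈ S, Real.log (Nat.card (R ⧸ P)) * (box.filter (· ∈ P)).card ≤
      M ^ d * (d * Real.log M + Real.log C₂) := by
    calc ∑ P ∈ S, Real.log (Nat.card (R ⧸ P)) * (box.filter (· ∈ P)).card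
        = ∑ a ∈ box, ∑ P ∈ S with a ∈ P, Real.log (Nat.card (R ⧸ P)) := by
          simp only [Finset.sum_filter]
          rw [Finset.sum_comm]
          refine Finset.sum_congr rfl fun P _ => ?_
          rw [← Finset.sum_filter, Finset.sum_const, nsmul_eq_mul, mul_comm]
      _ ≤ ∑ a ∈ box, (d * Real.log M + Real.log C₂) := Finset.sum_le_sum upper
      _ = box.card * (d * Real.log M + Real.log C₂) := by rw [Finset.sum_const, nsmul_eq_mul]
      _ ≤ M ^ d * (d * Real.log M + Real.log C₂) := by
          have h1 : (box.card : ℝ) ≤ M ^ d := by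
            have := Finset.card_erase_le (s := coordBox b B) (a := 0)
            rw [card_coordBox] at this
            rw [hM]
            exact_mod_cast this
          have := Real.log_nonneg hM1
          gcongr
  have lower : ∀ P ∈ S, M ^ d * (Real.log (Nat.card (R ⧸ P)) / Nat.card (R ⧸ P)) ≤
      Real.log (Nat.card (R ⧸ P)) * (box.filter (· ∈ P)).card + Real.log (Nat.card (R ⧸ P)) +
      C₁ * M ^ (d - 1) * (Real.log (Nat.card (R ⧸ P)) *
        ((Nat.card (R ⧸ P) : ℝ) ^ (1 / (d : ℝ)) / Nat.card (R ⧸ P))) := by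
    intro P hP
    have h1 := hcount P (hcard P hP) B
    have h2 : (((coordBox b B).filter (· ∈ P)).card : ℝ) ≤ (box.filter (· ∈ P)).card + 1 := by
      have : (coordBox b B).filter (· ∈ P) ⊆ insert 0 (box.filter (· ∈ P)) := by
        intro x hx
        by_cases hx0 : x = 0
        · simp [hx0]
        · obtain ⟨h, h'⟩ := Finset.mem_filter.1 hx
          exact Finset.mem_insert_of_mem
            (Finset.mem_filter.2 ⟨Finset.mem_erase.2 ⟨hx0, h⟩, h'⟩)
      exact_mod_cast (Finset.card_le_card this).trans (Finset.card_insert_le _ _)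
    have h3 := mul_le_mul_of_nonneg_left (h1.trans h2) (hlogq P hP)
    refine le_of_sub_nonneg ((sub_nonneg.2 h3).trans (le_of_eq ?_))
    ring
  have hsum := Finset.sum_le_sum lower
  rw [← Finset.mul_sum, Finset.sum_add_distrib, Finset.sum_add_distrib, ← Finset.mul_sum] at hsum
  refine hsum.trans ?_
  have hpos : 0 ≤ ∑ P ∈ S, Real.log (Nat.card (R ⧸ P)) *
        ((Nat.card (R ⧸ P) : ℝ) ^ (1 / (d : ℝ)) / Nat.card (R ⧸ P)) :=
    Finset.sum_nonneg fun P hP => mul_nonneg (hlogq P hP) (by positivity)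
  have h6 : M ^ d * (d * Real.log M + Real.log C₂) ≤
      M ^ d * (d * Real.log M + max C₁ (Real.log C₂)) := by
    gcongr
    exact le_max_right _ _
  have h7 := mul_le_mul_of_nonneg_right (mul_le_mul_of_nonneg_right (le_max_left C₁ (Real.log C₂))
    (by positivity : 0 ≤ M ^ (d - 1))) hpos
  linarith

end LogSum

/-! ### Roots modulo primes and the Mertens upper bound -/

section Mertens

open Module Polynomial

/-- The number of roots of `f` modulo `p`. -/
def rootCount (f : ℤ[X]) (p : ℕ) : ℕ :=
  ((Finset.range p).filter fun r : ℕ => (p : ℤ) ∣ f.eval (r : ℤ)).card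

theorem intCast_eval_eq_eval_map (f : ℤ[X]) (p : ℕ) (n : ℤ) :
    ((f.eval n : ℤ) : ZMod p) = (f.map (Int.castRingHom (ZMod p))).eval (n : ZMod p) := by
  simp

/-- Phrased for incongruent integers so as to serve both for the residues 0, …, p-1 and for the
integers ±n. -/
theorem card_le_natDegree_of_dvd_eval {f : ℤ[X]} (hf : f.Monic) {p : ℕ} (hp : p.Prime)
    (s : Finset ℤ) (hs : ∀ n ∈ s, (p : ℤ) ∣ f.eval n)
    (hinj : ∀ m ∈ s, ∀ n ∈ s, (p : ℤ) ∣ m - n → m = n) : s.card ≤ f.natDegree := by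
  have : Fact p.Prime := ⟨hp⟩
  classical
  have hmon : (f.map (Int.castRingHom (ZMod p))).Monic := hf.map _
  calc s.card ≤ (f.map (Int.castRingHom (ZMod p))).roots.toFinset.card := by
        refine Finset.card_le_card_of_injOn (fun n : ℤ => (n : ZMod p)) ?_ ?_
        · intro n hn
          rw [Finset.mem_coe, Multiset.mem_toFinset, mem_roots hmon.ne_zero, IsRoot.def,
            ← intCast_eval_eq_eval_map, ZMod.intCast_zmod_eq_zero_iff_dvd]
          exact hs n hn
        · intro m hm n hn h
          refine hinj m hm n hn ?_
          rw [← ZMod.intCast_zmod_eq_zero_iff_dvd, Int.cast_sub, sub_eq_zero]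
          exact h
    _ ≤ (f.map (Int.castRingHom (ZMod p))).roots.card := Multiset.toFinset_card_le _
    _ ≤ (f.map (Int.castRingHom (ZMod p))).natDegree := card_roots' _
    _ ≤ f.natDegree := natDegree_map_le

theorem rootCount_le_natDegree {f : ℤ[X]} (hf : f.Monic) {p : ℕ} (hp : p.Prime) :
    rootCount f p ≤ f.natDegree := by
  rw [rootCount, ← Finset.card_image_of_injective _ (Nat.cast_injective (R := ℤ))]
  refine card_le_natDegree_of_dvd_eval hf hp _ ?_ ?_
  · intro n hn
    obtain ⟨r, hr, rfl⟩ := Finset.mem_image.1 hn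
    exact (Finset.mem_filter.1 hr).2
  · intro m hm n hn h
    obtain ⟨r, hr, rfl⟩ := Finset.mem_image.1 hm
    obtain ⟨s, hs, rfl⟩ := Finset.mem_image.1 hn
    have hr := Finset.mem_range.1 (Finset.mem_filter.1 hr).1
    have hs := Finset.mem_range.1 (Finset.mem_filter.1 hs).1
    have := Int.eq_zero_of_abs_lt_dvd h (by rw [abs_lt]; constructor <;> omega)
    omega

theorem exists_ideal_of_dvd_eval {f : ℤ[X]} {p : ℕ} (hp : p.Prime) {r : ℕ}
    (hr : (p : ℤ) ∣ f.eval (r : ℤ)) : ∃ P : Ideal (AdjoinRoot f), P.IsMaximal ∧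
    Nat.card (AdjoinRoot f ⧸ P) = p ∧ (p : AdjoinRoot f) ∈ P ∧ AdjoinRoot.root f - r ∈ P := by
  have : Fact p.Prime := ⟨hp⟩
  have hr' : eval₂ (Int.castRingHom (ZMod p)) (r : ZMod p) f = 0 := by
    rw [← eval_map]
    have h := intCast_eval_eq_eval_map f p r
    rw [(ZMod.intCast_zmod_eq_zero_iff_dvd _ _).2 hr] at h
    simpa using h.symm
  set φ : AdjoinRoot f →+* ZMod p := AdjoinRoot.lift (Int.castRingHom (ZMod p)) r hr'
  have hφ : Function.Surjective φ := ZMod.ringHom_surjective φ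
  refine ⟨RingHom.ker φ, RingHom.ker_isMaximal_of_surjective φ hφ, ?_, ?_, ?_⟩
  · rw [Nat.card_congr (RingHom.quotientKerEquivOfSurjective hφ).toEquiv, Nat.card_zmod]
  · rw [RingHom.mem_ker, map_natCast, ZMod.natCast_self]
  · rw [RingHom.mem_ker, map_sub, map_natCast, AdjoinRoot.lift_root, sub_self]

/-- The ideals attached to distinct pairs (p, r) are distinct: p is the index, and an ideal
containing p and r - r' with p ∤ r - r' would contain 1. -/
theorem exists_finset_ideal_sum_eq (f : ℤ[X]) (x : ℕ) : ∃ S : Finset (Ideal (AdjoinRoot f)),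
    (∀ P ∈ S, P.IsMaximal) ∧ (∀ P ∈ S, Nat.card (AdjoinRoot f ⧸ P) ≠ 0) ∧
    ∀ g : ℕ → ℝ, ∑ P ∈ S, g (Nat.card (AdjoinRoot f ⧸ P)) =
      ∑ p ∈ x.primesLE, rootCount f p * g p := by
  classical
  set I : Finset (Σ _ : ℕ, ℕ) := x.primesLE.sigma fun p =>
    (Finset.range p).filter fun r : ℕ => (p : ℤ) ∣ f.eval (r : ℤ)
  have hI : ∀ i : Σ _ : ℕ, ℕ, ∃ P : Ideal (AdjoinRoot f), i ∈ I → P.IsMaximal ∧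
      Nat.card (AdjoinRoot f ⧸ P) = i.1 ∧ (i.1 : AdjoinRoot f) ∈ P ∧
      AdjoinRoot.root f - i.2 ∈ P := by
    intro i
    by_cases hi : i ∈ I
    · obtain ⟨h1, h2⟩ := Finset.mem_sigma.1 hi
      obtain ⟨P, hP⟩ := exists_ideal_of_dvd_eval (Nat.prime_of_mem_primesLE h1)
        (Finset.mem_filter.1 h2).2
      exact ⟨P, fun _ => hP⟩
    · exact ⟨⊥, fun h => absurd h hi⟩
  choose P hP using hI
  have hprime : ∀ i ∈ I, i.1.Prime := fun i hi =>
    Nat.prime_of_mem_primesLE (Finset.mem_sigma.1 hi).1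
  have hinj : Set.InjOn P I := by
    rintro ⟨p, r⟩ hi ⟨p', r'⟩ hj h
    obtain ⟨hmax, hc, hp, hr⟩ := hP _ hi
    obtain ⟨-, hc', -, hr'⟩ := hP _ hj
    rw [← h] at hc' hr'
    simp only at hc hc' hp hr hr'
    obtain rfl : p = p' := hc.symm.trans hc'
    have hdiff : ((r - r' : ℤ) : AdjoinRoot f) ∈ P ⟨p, r⟩ := by
      have := (P ⟨p, r⟩).sub_mem hr' hr
      push_cast
      convert this using 1
      ring
    have hdvd : (p : ℤ) ∣ (r : ℤ) - r' := by
      by_contra hnd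
      have hcop : IsCoprime (p : ℤ) (r - r') :=
        (Nat.prime_iff_prime_int.1 (hprime _ hi)).coprime_iff_not_dvd.2 hnd
      obtain ⟨u, v, huv⟩ := hcop
      refine hmax.ne_top ((Ideal.eq_top_iff_one _).2 ?_)
      have h1 : ((u * p + v * (r - r') : ℤ) : AdjoinRoot f) = 1 := by rw [huv, Int.cast_one]
      rw [← h1]
      push_cast at hdiff ⊢
      exact Ideal.add_mem _ (Ideal.mul_mem_left _ _ hp) (Ideal.mul_mem_left _ _ hdiff)
    have h1 := Finset.mem_range.1 (Finset.mem_filter.1 (Finset.mem_sigma.1 hi).2).1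
    have h2 := Finset.mem_range.1 (Finset.mem_filter.1 (Finset.mem_sigma.1 hj).2).1
    simp only at h1 h2
    have := Int.eq_zero_of_abs_lt_dvd hdvd (by rw [abs_lt]; constructor <;> omega)
    obtain rfl : r = r' := by omega
    rfl
  refine ⟨I.image P, ?_, ?_, ?_⟩
  · intro Q hQ
    obtain ⟨i, hi, rfl⟩ := Finset.mem_image.1 hQ
    exact (hP i hi).1
  · intro Q hQ
    obtain ⟨i, hi, rfl⟩ := Finset.mem_image.1 hQ
    rw [(hP i hi).2.1]
    exact (hprime i hi).ne_zero
  · intro g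
    rw [Finset.sum_image hinj]
    calc ∑ i ∈ I, g (Nat.card (AdjoinRoot f ⧸ P i)) = ∑ i ∈ I, g i.1 :=
          Finset.sum_congr rfl fun i hi => by rw [(hP i hi).2.1]
      _ = _ := by
          rw [Finset.sum_sigma]
          refine Finset.sum_congr rfl fun p _ => ?_
          simp only [Finset.sum_const, nsmul_eq_mul, rootCount]

theorem sum_mul_antitone_le {a g : ℕ → ℝ} {c : ℝ}
    (ha : ∀ n, ∑ m ∈ Finset.Icc 1 n, a m ≤ c * n) (hg0 : ∀ n, 0 ≤ g n)
    (hg : ∀ n, 1 ≤ n → g (n + 1) ≤ g n) (n : ℕ) :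
    ∑ m ∈ Finset.Icc 1 n, a m * g m ≤ c * ∑ m ∈ Finset.Icc 1 n, g m := by
  -- Abel summation by induction: the nonpositive boundary term is carried along and dropped at the
  -- end.
  suffices h : ∀ n, ∑ m ∈ Finset.Icc 1 n, a m * g m ≤
      (∑ m ∈ Finset.Icc 1 n, a m - c * n) * g n + c * ∑ m ∈ Finset.Icc 1 n, g m by
    have h1 := mul_nonneg (sub_nonneg.2 (ha n)) (hg0 n)
    linarith [h n]
  intro n
  induction n with
  | zero => simp
  | succ n ih =>
    rw [Finset.sum_Icc_succ_top (by omega), Finset.sum_Icc_succ_top (by omega),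
      Finset.sum_Icc_succ_top (by omega)]
    have h1 : (∑ m ∈ Finset.Icc 1 n, a m - c * n) * g n ≤
        (∑ m ∈ Finset.Icc 1 n, a m - c * n) * g (n + 1) := by
      rcases Nat.eq_zero_or_pos n with rfl | hn
      · simp
      · exact mul_le_mul_of_nonpos_left (hg n hn) (sub_nonpos.2 (ha n))
    push_cast
    linarith

/-- Bernoulli's inequality for an exponent s ≤ 1 gives m^(s-1) ≤ (m^s - (m-1)^s)/s, which
telescopes. -/
theorem sum_rpow_div_le {s : ℝ} (hs : 0 < s) (hs1 : s ≤ 1) (n : ℕ) :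
    ∑ m ∈ Finset.Icc 1 n, (m : ℝ) ^ s / m ≤ 1 / s * (n : ℝ) ^ s := by
  induction n with
  | zero => simp [Real.zero_rpow hs.ne']
  | succ n ih =>
    rw [Finset.sum_Icc_succ_top (by omega)]
    have hn : (0 : ℝ) < (n + 1 : ℕ) := by positivity
    have h1 := rpow_one_add_le_one_add_mul_self (s := -(1 / ((n + 1 : ℕ) : ℝ))) (p := s) (by
      rw [neg_le_neg_iff, div_le_one hn]; push_cast; linarith [(Nat.cast_nonneg n : (0:ℝ) ≤ n)])
      hs.le hs1
    have h2 : (n : ℝ) = (n + 1 : ℕ) * (1 + -(1 / ((n + 1 : ℕ) : ℝ))) := by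
      push_cast; field_simp; ring
    have h3 : (n : ℝ) ^ s ≤ ((n + 1 : ℕ) : ℝ) ^ s * (1 + s * -(1 / ((n + 1 : ℕ) : ℝ))) := by
      conv_lhs => rw [h2]
      rw [Real.mul_rpow hn.le]
      · gcongr
      · rw [← sub_eq_add_neg, sub_nonneg, div_le_one hn]; push_cast
        linarith [(Nat.cast_nonneg n : (0:ℝ) ≤ n)]
    have h4 := mul_le_mul_of_nonneg_left h3 (one_div_pos.2 hs).le
    refine (add_le_add_left (ih.trans h4) _).trans (le_of_eq ?_)
    field_simp
    ring

theorem rpow_div_succ_le {s : ℝ} (hs1 : s ≤ 1) (n : ℕ) (hn : 1 ≤ n) :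
    ((n + 1 : ℕ) : ℝ) ^ s / (n + 1 : ℕ) ≤ (n : ℝ) ^ s / n := by
  have hn0 : (0 : ℝ) < n := by positivity
  rw [← Real.rpow_sub_one (by positivity), ← Real.rpow_sub_one (by positivity)]
  exact Real.rpow_le_rpow_of_nonpos hn0 (by push_cast; linarith) (by linarith)

theorem sum_primesLE_eq (n : ℕ) (g : ℕ → ℝ) :
    ∑ p ∈ n.primesLE, g p = ∑ m ∈ Finset.Icc 1 n, if m.Prime then g m else 0 := by
  rw [← Finset.sum_filter]
  refine Finset.sum_congr ?_ fun _ _ => rfl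
  ext p
  simp only [Nat.mem_primesLE, Finset.mem_filter, Finset.mem_Icc]
  exact ⟨fun h => ⟨⟨h.2.one_lt.le, h.1⟩, h.2⟩, fun h => ⟨h.1.2, h.2⟩⟩

theorem sum_log_primesLE_le (n : ℕ) : ∑ p ∈ n.primesLE, Real.log p ≤ Real.log 4 * n := by
  rw [← Chebyshev.theta_eq_sum_primesLE_log]
  exact Chebyshev.theta_le_log4_mul_x (Nat.cast_nonneg n)

theorem sum_log_mul_rpow_div_le {s : ℝ} (hs : 0 < s) (hs1 : s ≤ 1) (n : ℕ) :
    ∑ p ∈ n.primesLE, Real.log p * ((p : ℝ) ^ s / p) ≤ Real.log 4 * (1 / s * (n : ℝ) ^ s) := by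
  have h := sum_mul_antitone_le (a := fun m => if m.Prime then Real.log m else 0)
    (g := fun m => (m : ℝ) ^ s / m) (c := Real.log 4)
    (fun n => by rw [← sum_primesLE_eq n fun m => Real.log m]; exact sum_log_primesLE_le n)
    (fun n => by positivity) (rpow_div_succ_le hs1) n
  rw [sum_primesLE_eq n fun p => Real.log p * ((p : ℝ) ^ s / p)]
  simp only [ite_mul, zero_mul] at h
  exact h.trans (mul_le_mul_of_nonneg_left (sum_rpow_div_le hs hs1 n)
    (Real.log_nonneg (by norm_num)))

theorem exists_sum_rootCount_mul_log_div_le {f : ℤ[X]} (hf : f.Monic) (hirr : Irreducible f) :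
    ∃ C : ℝ, ∀ x : ℕ, 1 ≤ x →
      ∑ p ∈ x.primesLE, rootCount f p * (Real.log p / p) ≤ Real.log x + C := by
  have : IsDomain (AdjoinRoot f) := AdjoinRoot.isDomain_of_prime hirr.prime
  let b := (AdjoinRoot.powerBasis' hf).basis
  have hdim : (AdjoinRoot.powerBasis' hf).dim = f.natDegree := rfl
  have hd0 : 0 < f.natDegree := by
    rw [Nat.pos_iff_ne_zero]
    intro h
    exact hirr.not_isUnit (by rw [hf.natDegree_eq_zero.1 h]; exact isUnit_one)
  have : Nonempty (Fin (AdjoinRoot.powerBasis' hf).dim) := ⟨⟨0, hd0⟩⟩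
  obtain ⟨C, hC, hmain⟩ := exists_sum_log_div_le b
  rw [Fintype.card_fin, hdim] at hmain
  set d := f.natDegree
  refine ⟨d * Real.log 5 + C + d * Real.log 4 + C * (d * (Real.log 4 * d)), fun x hx => ?_⟩
  obtain ⟨S, hS, hS', hsum⟩ := exists_finset_ideal_sum_eq f x
  set r : ℝ := (x : ℝ) ^ (1 / (d : ℝ)) with hr
  have hx1 : (1 : ℝ) ≤ x := by exact_mod_cast hx
  have hr1 : 1 ≤ r := Real.one_le_rpow hx1 (by positivity)
  have hrd : r ^ d = x := by
    rw [hr, one_div, Real.rpow_inv_natCast_pow (by positivity) hd0.ne']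
  -- With this radius x ≤ M^d ≤ 5^d x, so d log M = log x + O(1), and by Chebyshev both error sums
  -- are O(M^d).
  have hmain := hmain S hS hS' ⌈r⌉₊
  rw [hsum fun q => Real.log q / q, hsum fun q => Real.log q,
    hsum fun q => Real.log q * ((q : ℝ) ^ (1 / (d : ℝ)) / q)] at hmain
  set M : ℝ := 2 * ⌈r⌉₊ + 1
  have hM1 : r ≤ M := by linarith [Nat.le_ceil r]
  have hM2 : M ≤ 5 * r := by linarith [Nat.ceil_lt_add_one (zero_le_one.trans hr1)]
  have hM0 : 0 < M := by linarith
  have hlog4 : 0 ≤ Real.log 4 := Real.log_nonneg (by norm_num)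
  have hrho : ∀ g : ℕ → ℝ, (∀ n, 0 ≤ g n) →
      ∑ p ∈ x.primesLE, rootCount f p * g p ≤ d * ∑ p ∈ x.primesLE, g p := by
    intro g hg
    rw [Finset.mul_sum]
    refine Finset.sum_le_sum fun p hp => mul_le_mul_of_nonneg_right ?_ (hg p)
    exact_mod_cast rootCount_le_natDegree hf (Nat.prime_of_mem_primesLE hp)
  have h1 : ∑ p ∈ x.primesLE, rootCount f p * Real.log p ≤ d * Real.log 4 * M ^ d := by
    refine (hrho _ fun n => Real.log_natCast_nonneg n).trans ?_
    rw [mul_assoc]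
    gcongr
    refine (sum_log_primesLE_le x).trans ?_
    rw [← hrd]
    gcongr
  have h2 : ∑ p ∈ x.primesLE, rootCount f p * (Real.log p * ((p : ℝ) ^ (1 / (d : ℝ)) / p)) ≤
      d * (Real.log 4 * d) * M := by
    refine (hrho _ fun n => mul_nonneg (Real.log_natCast_nonneg n) (by positivity)).trans ?_
    have hd1 : (1 : ℝ) ≤ d := by exact_mod_cast hd0
    have := sum_log_mul_rpow_div_le (s := 1 / (d : ℝ)) (by positivity)
      (by rw [div_le_one (by positivity)]; exact hd1) x
    rw [one_div_one_div, ← hr] at this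
    rw [mul_assoc]
    gcongr
    refine this.trans ?_
    rw [mul_assoc]
    gcongr
  have h3 : d * Real.log M ≤ d * Real.log 5 + Real.log x := by
    rw [← hrd, Real.log_pow, ← mul_add, ← Real.log_mul (by norm_num) (by positivity)]
    gcongr
  have hMd : M ^ d = M ^ (d - 1) * M := (pow_sub_one_mul hd0.ne' M).symm
  refine le_of_mul_le_mul_left (hmain.trans ?_) (pow_pos hM0 d)
  have h4 : C * M ^ (d - 1) * ∑ p ∈ x.primesLE,
      rootCount f p * (Real.log p * ((p : ℝ) ^ (1 / (d : ℝ)) / p)) ≤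
      M ^ d * (C * (d * (Real.log 4 * d))) := by
    refine (mul_le_mul_of_nonneg_left h2 (by positivity)).trans (le_of_eq ?_)
    rw [hMd]; ring
  have h5 := mul_le_mul_of_nonneg_left h3 (pow_pos hM0 d).le
  linarith

end Mertens

/-! ### Solutions of f(n) ≡ 0 modulo prime powers -/

section Counting

open Module Polynomial

/-- The class of f' in the domain ℤ[X]/(f) is nonzero by degree, and it divides its norm D. Here D
plays the role of the discriminant. -/
theorem exists_bezout_derivative {f : ℤ[X]} (hf : f.Monic) (hirr : Irreducible f) :
    ∃ D : ℕ, D ≠ 0 ∧ ∃ u v : ℤ[X], u * f + v * derivative f = C (D : ℤ) := by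
  have : IsDomain (AdjoinRoot f) := AdjoinRoot.isDomain_of_prime hirr.prime
  have hd0 : f.natDegree ≠ 0 := by
    intro h
    exact hirr.not_isUnit (by rw [hf.natDegree_eq_zero.1 h]; exact isUnit_one)
  have hder : derivative f ≠ 0 := fun h => hd0 (derivative_eq_zero.1 h)
  have hne := AdjoinRoot.mk_ne_zero_of_natDegree_lt hf hder (natDegree_derivative_lt hd0)
  let b := (AdjoinRoot.powerBasis' hf).basis
  obtain ⟨w, hw⟩ := dvd_natAbs_norm b hne
  obtain ⟨v, rfl⟩ := AdjoinRoot.mk_surjective w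
  refine ⟨(Algebra.norm ℤ (AdjoinRoot.mk f (derivative f))).natAbs, ?_, ?_⟩
  · rw [Int.natAbs_ne_zero, Algebra.norm_ne_zero_iff_of_basis b]; exact hne
  · set D := (Algebra.norm ℤ (AdjoinRoot.mk f (derivative f))).natAbs
    have h : AdjoinRoot.mk f (C (D : ℤ)) = AdjoinRoot.mk f (derivative f * v) := by
      rw [map_mul, ← hw]
      exact map_natCast ((AdjoinRoot.mk f).comp C) D
    obtain ⟨u, hu⟩ := AdjoinRoot.mk_eq_mk.1 h
    exact ⟨u, v, by linear_combination -hu⟩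

theorem Prime.pow_sub_dvd_of_pow_dvd_mul {α : Type*} [CommRing α] [IsDomain α] {p : α}
    (hp : Prime p) {e k : ℕ} {a b : α} (hb : ¬ p ^ (e + 1) ∣ b) (hab : p ^ k ∣ a * b) :
    p ^ (k - e) ∣ a := by
  classical
  have hex : ∃ l, ¬ p ^ (l + 1) ∣ b := ⟨e, hb⟩
  obtain ⟨l, hl, hle, hlb⟩ : ∃ l, ¬ p ^ (l + 1) ∣ b ∧ l ≤ e ∧ p ^ l ∣ b := by
    refine ⟨Nat.find hex, Nat.find_spec hex, Nat.find_min' hex hb, ?_⟩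
    rcases h : Nat.find hex with _ | l
    · simp
    · exact not_not.1 (Nat.find_min hex (m := l) (by omega))
  suffices h : ∀ j, j ≤ k - e → p ^ j ∣ a from h _ le_rfl
  intro j
  induction j with
  | zero => simp
  | succ j ih =>
    intro hj
    exact (succ_dvd_or_succ_dvd_of_succ_sum_dvd_mul hp (ih (by omega)) hlb
      ((pow_dvd_pow p (by omega)).trans hab)).resolve_right hl

/-- Uniqueness in Hensel's lemma: f(m) - f(n) = (m - n)(f'(n) + t(m - n)). If p^(e+1) divided the
second factor, it would divide f'(n) and f(n), hence D. -/
theorem pow_sub_dvd_sub_of_pow_dvd_eval {f u v : ℤ[X]} {D : ℕ}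
    (hD : u * f + v * derivative f = C (D : ℤ)) {p : ℕ} (hp : p.Prime) {e k : ℕ}
    (he : ¬ p ^ (e + 1) ∣ D) (hk : e + 1 ≤ k) {m n : ℤ} (hm : (p : ℤ) ^ k ∣ f.eval m)
    (hn : (p : ℤ) ^ k ∣ f.eval n) (hmn : (p : ℤ) ^ (e + 1) ∣ m - n) :
    (p : ℤ) ^ (k - e) ∣ m - n := by
  obtain ⟨t, ht⟩ := f.binomExpansion n (m - n)
  rw [add_sub_cancel] at ht
  refine Prime.pow_sub_dvd_of_pow_dvd_mul (Nat.prime_iff_prime_int.1 hp) (e := e)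
    (b := (derivative f).eval n + t * (m - n)) ?_ ?_
  · intro h
    have h1 : (p : ℤ) ^ (e + 1) ∣ (derivative f).eval n :=
      (dvd_add_left (hmn.mul_left t)).1 h
    have h2 : (p : ℤ) ^ (e + 1) ∣ f.eval n := (pow_dvd_pow _ hk).trans hn
    have h3 := congrArg (eval n) hD
    rw [eval_add, eval_mul, eval_mul, eval_C] at h3
    have h4 := dvd_add (h2.mul_left (u.eval n)) (h1.mul_left (v.eval n))
    rw [h3] at h4
    exact he (by exact_mod_cast h4)
  · have h := dvd_sub hm hn
    convert h using 1
    rw [ht]; ring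

theorem card_le_of_pairwise_dvd_sub {N M : ℕ} {s : Finset ℕ} (hs : s ⊆ Finset.Icc 1 N)
    (h : ∀ m ∈ s, ∀ n ∈ s, (M : ℤ) ∣ (m : ℤ) - n) : s.card ≤ N / M + 1 := by
  rw [← Finset.card_range (N / M + 1)]
  refine Finset.card_le_card_of_injOn (· / M) ?_ ?_
  · intro n hn
    rw [Finset.mem_coe, Finset.mem_range, Nat.lt_succ_iff]
    exact Nat.div_le_div_right (Finset.mem_Icc.1 (hs hn)).2
  · intro m hm n hn hmn
    have h1 : n ≡ m [MOD M] := Nat.modEq_iff_dvd.2 (h m hm n hn)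
    rw [← Nat.div_add_mod m M, ← Nat.div_add_mod n M, h1]
    simp only at hmn
    rw [hmn]

/-- The number of `1 ≤ n ≤ N` such that `m` divides `f n`. -/
def dvdCount (f : ℤ[X]) (N m : ℕ) : ℕ :=
  ((Finset.Icc 1 N).filter fun n : ℕ => (m : ℤ) ∣ f.eval (n : ℤ)).card

theorem dvdCount_pow_le_mul {f u v : ℤ[X]} {D : ℕ}
    (hD : u * f + v * derivative f = C (D : ℤ)) {p : ℕ} (hp : p.Prime) {e k : ℕ}
    (he : ¬ p ^ (e + 1) ∣ D) (hk : e + 1 ≤ k) (N : ℕ) {t : Finset ℕ}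
    (ht : ∀ n : ℕ, (p : ℤ) ^ k ∣ f.eval (n : ℤ) → n % p ^ (e + 1) ∈ t) :
    dvdCount f N (p ^ k) ≤ (N / p ^ (k - e) + 1) * t.card := by
  refine Finset.card_le_mul_card_image_of_maps_to (f := (· % p ^ (e + 1))) ?_ _ ?_
  · intro n hn
    exact ht n (by exact_mod_cast (Finset.mem_filter.1 hn).2)
  · intro c _
    refine card_le_of_pairwise_dvd_sub
      ((Finset.filter_subset _ _).trans (Finset.filter_subset _ _)) ?_
    intro m hm n hn
    obtain ⟨hm, hmc⟩ := Finset.mem_filter.1 hm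
    obtain ⟨hn, hnc⟩ := Finset.mem_filter.1 hn
    have hm := (Finset.mem_filter.1 hm).2
    have hn := (Finset.mem_filter.1 hn).2
    push_cast at hm hn ⊢
    refine pow_sub_dvd_sub_of_pow_dvd_eval hD hp he hk hm hn ?_
    have h1 : n ≡ m [MOD p ^ (e + 1)] := hnc.trans hmc.symm
    exact_mod_cast Nat.modEq_iff_dvd.1 h1

theorem dvdCount_pow_le_of_not_dvd {f u v : ℤ[X]} {D : ℕ}
    (hD : u * f + v * derivative f = C (D : ℤ)) {p : ℕ} (hp : p.Prime) (hpD : ¬ p ∣ D) {k : ℕ}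
    (hk : 1 ≤ k) (N : ℕ) :
    (dvdCount f N (p ^ k) : ℝ) ≤ rootCount f p * (N / (p : ℝ) ^ k + 1) := by
  have h := dvdCount_pow_le_mul hD hp (e := 0) (by simpa using hpD) hk N
    (t := (Finset.range p).filter fun r : ℕ => (p : ℤ) ∣ f.eval (r : ℤ)) (by
      intro n hn
      rw [zero_add, pow_one, Finset.mem_filter, Finset.mem_range]
      refine ⟨Nat.mod_lt _ hp.pos, ?_⟩
      have h1 : (p : ℤ) ∣ f.eval (n : ℤ) := (dvd_pow_self _ (by omega)).trans hn
      have h2 : (p : ℤ) ∣ (n : ℤ) - (n % p : ℕ) := Nat.modEq_iff_dvd.1 (Nat.mod_modEq n p)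
      exact (dvd_sub_right h1).1 (h2.trans (sub_dvd_eval_sub _ _ f)))
  rw [mul_comm]
  have h2 : (dvdCount f N (p ^ k) : ℝ) ≤ ((N / p ^ k : ℕ) + 1) * rootCount f p := by
    exact_mod_cast h
  refine h2.trans ?_
  gcongr
  exact_mod_cast Nat.cast_div_le (α := ℝ) (m := N) (n := p ^ k)

theorem exists_dvdCount_pow_le {f u v : ℤ[X]} {D : ℕ} (hD0 : D ≠ 0)
    (hD : u * f + v * derivative f = C (D : ℤ)) {p : ℕ} (hp : p.Prime) :
    ∃ A : ℝ, 0 ≤ A ∧ ∀ k N : ℕ,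
      (dvdCount f N (p ^ k) : ℝ) ≤ A * (N / (p : ℝ) ^ k + 1) := by
  -- The crude choice e = D suffices: this bound is needed only at the finitely many p ∣ D, so A may
  -- be any constant independent of k and N.
  obtain ⟨e, he⟩ : ∃ e, ¬ p ^ (e + 1) ∣ D :=
    ⟨D, fun h => absurd (Nat.le_of_dvd (Nat.pos_of_ne_zero hD0) h)
      (not_le.2 ((Nat.lt_succ_self D).trans (Nat.lt_pow_self hp.one_lt)))⟩
  have hp1 : (1 : ℝ) ≤ p := by exact_mod_cast hp.one_lt.le
  have hp0 : (0 : ℝ) < p := by linarith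
  refine ⟨(p : ℝ) ^ (2 * e + 1), by positivity, fun k N => ?_⟩
  rcases le_or_gt (e + 1) k with hk | hk
  · have h := dvdCount_pow_le_mul hD hp he hk N (t := Finset.range (p ^ (e + 1)))
      (fun n _ => Finset.mem_range.2 (Nat.mod_lt _ (pow_pos hp.pos _)))
    rw [Finset.card_range] at h
    have h2 : (dvdCount f N (p ^ k) : ℝ) ≤ ((N / p ^ (k - e) : ℕ) + 1) * (p : ℝ) ^ (e + 1) := by
      exact_mod_cast h
    have h3 : ((N / p ^ (k - e) : ℕ) : ℝ) ≤ N / (p : ℝ) ^ (k - e) := by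
      exact_mod_cast Nat.cast_div_le (α := ℝ) (m := N) (n := p ^ (k - e))
    have h4 : (p : ℝ) ^ k = (p : ℝ) ^ (k - e) * (p : ℝ) ^ e := by
      rw [← pow_add]; congr 1; omega
    calc (dvdCount f N (p ^ k) : ℝ) ≤ (N / (p : ℝ) ^ (k - e) + 1) * (p : ℝ) ^ (e + 1) := by
          refine h2.trans ?_; gcongr
      _ ≤ (N / (p : ℝ) ^ (k - e) + (p : ℝ) ^ e) * (p : ℝ) ^ (e + 1) := by
          gcongr; exact one_le_pow₀ hp1
      _ = (p : ℝ) ^ (2 * e + 1) * (N / (p : ℝ) ^ k + 1) := by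
          rw [h4]; field_simp; ring
  · have h1 : (dvdCount f N (p ^ k) : ℝ) ≤ N := by
      have := Finset.card_filter_le (Finset.Icc 1 N) fun n : ℕ =>
        ((p ^ k : ℕ) : ℤ) ∣ f.eval (n : ℤ)
      rw [Nat.card_Icc, Nat.add_sub_cancel] at this
      exact_mod_cast this
    have h2 : (p : ℝ) ^ k ≤ (p : ℝ) ^ (2 * e + 1) := pow_le_pow_right₀ hp1 (by omega)
    have h3 : (N : ℝ) ≤ (p : ℝ) ^ (2 * e + 1) * (N / (p : ℝ) ^ k) := by
      rw [mul_div_assoc', le_div_iff₀ (by positivity), mul_comm]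
      gcongr
    have h4 : (0 : ℝ) ≤ (p : ℝ) ^ (2 * e + 1) := by positivity
    linarith

/-- The exponent of `p` in `f 1 * ⋯ * f N`. -/
noncomputable def prodExponent (f : ℤ[X]) (N p : ℕ) : ℕ :=
  ∑ n ∈ Finset.Icc 1 N, (f.eval (n : ℤ)).natAbs.factorization p

theorem prodExponent_le_sum_dvdCount {f : ℤ[X]} {N p H : ℕ} (hp : p.Prime)
    (h0 : ∀ n ∈ Finset.Icc 1 N, f.eval (n : ℤ) ≠ 0)
    (hH : ∀ n ∈ Finset.Icc 1 N, (f.eval (n : ℤ)).natAbs ≤ H) :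
    prodExponent f N p ≤ ∑ k ∈ Finset.Ico 1 (Nat.log p H + 1), dvdCount f N (p ^ k) := by
  simp only [prodExponent, dvdCount, Finset.card_filter]
  rw [Finset.sum_comm]
  refine Finset.sum_le_sum fun n hn => ?_
  rw [← Finset.card_filter]
  have hn0 : (f.eval (n : ℤ)).natAbs ≠ 0 := Int.natAbs_ne_zero.2 (h0 n hn)
  calc (f.eval (n : ℤ)).natAbs.factorization p
      = (Finset.Ico 1 ((f.eval (n : ℤ)).natAbs.factorization p + 1)).card := by simp
    _ ≤ _ := by
      refine Finset.card_le_card fun k hk => ?_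
      obtain ⟨hk1, hk2⟩ := Finset.mem_Ico.1 hk
      have hdvd := (hp.pow_dvd_iff_le_factorization hn0).2 (Nat.lt_succ_iff.1 hk2)
      refine Finset.mem_filter.2 ⟨Finset.mem_Ico.2 ⟨hk1, Nat.lt_succ_iff.2 ?_⟩, ?_⟩
      · exact Nat.le_log_of_pow_le hp.one_lt
          ((Nat.le_of_dvd (Nat.pos_of_ne_zero hn0) hdvd).trans (hH n hn))
      · exact Int.natCast_dvd.2 hdvd

/-- Sum the counts over 1 ≤ k ≤ log_p H: the terms N/p^k form a geometric series, and the terms 1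
cost at most log H after multiplication by log p. -/
theorem prodExponent_mul_log_le {f : ℤ[X]} {N p H : ℕ} {A : ℝ} (hA : 0 ≤ A) (hp : p.Prime)
    (h0 : ∀ n ∈ Finset.Icc 1 N, f.eval (n : ℤ) ≠ 0) (hH0 : H ≠ 0)
    (hH : ∀ n ∈ Finset.Icc 1 N, (f.eval (n : ℤ)).natAbs ≤ H)
    (hcount : ∀ k, 1 ≤ k → (dvdCount f N (p ^ k) : ℝ) ≤ A * (N / (p : ℝ) ^ k + 1)) :
    prodExponent f N p * Real.log p ≤
      A * (N * (Real.log p / p + 2 * (Real.log p / (p : ℝ) ^ 2)) + Real.log H) := by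
  have hp2 : (2 : ℝ) ≤ p := by exact_mod_cast hp.two_le
  have hlogp : 0 ≤ Real.log p := Real.log_natCast_nonneg p
  set K := Nat.log p H
  have h1 : (prodExponent f N p : ℝ) ≤ A * (N * (1 / p + 2 / (p : ℝ) ^ 2) + K) := by
    calc (prodExponent f N p : ℝ) ≤ ∑ k ∈ Finset.Ico 1 (K + 1), (dvdCount f N (p ^ k) : ℝ) := by
          exact_mod_cast prodExponent_le_sum_dvdCount hp h0 hH
      _ ≤ ∑ k ∈ Finset.Ico 1 (K + 1), A * (N / (p : ℝ) ^ k + 1) :=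
          Finset.sum_le_sum fun k hk => hcount k (Finset.mem_Ico.1 hk).1
      _ = A * (N * ∑ k ∈ Finset.Ico 1 (K + 1), ((p : ℝ)⁻¹) ^ k + K) := by
          rw [← Finset.mul_sum, Finset.sum_add_distrib, Finset.mul_sum]
          simp [div_eq_mul_inv]
      _ ≤ A * (N * (1 / p + 2 / (p : ℝ) ^ 2) + K) := by
          gcongr
          refine (geom_sum_Ico_le_of_lt_one (by positivity)
            (inv_lt_one_of_one_lt₀ (by linarith))).trans ?_
          rw [pow_one, show (p : ℝ)⁻¹ / (1 - (p : ℝ)⁻¹) = 1 / (p - 1) by field_simp,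
            show 1 / (p : ℝ) + 2 / (p : ℝ) ^ 2 = (p + 2) / p ^ 2 by field_simp,
            div_le_div_iff₀ (by linarith) (by positivity)]
          nlinarith
  have h2 : K * Real.log p ≤ Real.log H := by
    rw [← Real.log_pow]
    refine Real.log_le_log (by positivity) ?_
    exact_mod_cast Nat.pow_log_le_self p hH0
  calc prodExponent f N p * Real.log p
      ≤ A * (N * (1 / p + 2 / (p : ℝ) ^ 2) + K) * Real.log p := by gcongr
    _ = A * (N * (Real.log p / p + 2 * (Real.log p / (p : ℝ) ^ 2)) + K * Real.log p) := by ring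
    _ ≤ _ := by gcongr

end Counting

/-! ### Contribution of the primes up to 2N -/

section SmallPrimes

open Module Polynomial

theorem exists_card_primesLE_mul_log_le :
    ∃ C : ℝ, 0 ≤ C ∧ ∀ n : ℕ, 1 ≤ n → n.primesLE.card * Real.log n ≤ C * n := by
  have hlog4 : 0 ≤ Real.log 4 := Real.log_nonneg (by norm_num)
  refine ⟨2 * Real.log 4 + 2, by positivity, fun n hn => ?_⟩
  rcases hn.eq_or_lt with rfl | hn
  · simp; positivity
  have hn1 : (1 : ℝ) < n := by exact_mod_cast hn
  have hn0 : (0 : ℝ) ≤ n := by linarith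
  have hlog : 0 < Real.log n := Real.log_pos hn1
  have h := Chebyshev.pi_le_log4_mul_div hn1
  rw [Nat.floor_natCast, Real.log_sqrt hn0, ← Nat.primesLE_card_eq_primeCounting] at h
  have h1 : Real.log n ≤ 2 * √n := by
    have := Real.log_le_self (Real.sqrt_nonneg n)
    rw [Real.log_sqrt hn0] at this
    linarith
  calc n.primesLE.card * Real.log n
      ≤ (Real.log 4 * n / (Real.log n / 2) + √n) * Real.log n := by gcongr
    _ = 2 * Real.log 4 * n + √n * Real.log n := by field_simp
    _ ≤ 2 * Real.log 4 * n + √n * (2 * √n) := by gcongr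
    _ = (2 * Real.log 4 + 2) * n := by
      rw [mul_left_comm, Real.mul_self_sqrt hn0]; ring

theorem exists_sum_log_div_sq_le :
    ∃ C : ℝ, 0 ≤ C ∧ ∀ s : Finset ℕ, ∑ n ∈ s, Real.log n / (n : ℝ) ^ 2 ≤ C := by
  have hsum : Summable fun n : ℕ => (n : ℝ) ^ (-(3 / 2) : ℝ) :=
    Real.summable_nat_rpow.2 (by norm_num)
  refine ⟨2 * ∑' n : ℕ, (n : ℝ) ^ (-(3 / 2) : ℝ),
    mul_nonneg (by norm_num) (tsum_nonneg fun n => by positivity), fun s => ?_⟩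
  calc ∑ n ∈ s, Real.log n / (n : ℝ) ^ 2 ≤ ∑ n ∈ s, 2 * (n : ℝ) ^ (-(3 / 2) : ℝ) := by
        refine Finset.sum_le_sum fun n _ => ?_
        rcases Nat.eq_zero_or_pos n with rfl | hn
        · simp
        have hn0 : (0 : ℝ) < n := by exact_mod_cast hn
        have h := Real.log_le_rpow_div hn0.le (show (0 : ℝ) < 1 / 2 by norm_num)
        rw [div_le_iff₀ (by positivity), mul_assoc, ← Real.rpow_natCast, ← Real.rpow_add hn0]
        norm_num at h ⊢
        linarith
    _ = 2 * ∑ n ∈ s, (n : ℝ) ^ (-(3 / 2) : ℝ) := by rw [Finset.mul_sum]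
    _ ≤ _ := by
        gcongr
        exact hsum.sum_le_tsum s fun n _ => by positivity

theorem exists_natAbs_eval_le (f : ℤ[X]) :
    ∃ c : ℕ, c ≠ 0 ∧ ∀ n N : ℕ, 1 ≤ N → n ≤ N →
      (f.eval (n : ℤ)).natAbs ≤ c * N ^ f.natDegree := by
  refine ⟨∑ i ∈ Finset.range (f.natDegree + 1), (f.coeff i).natAbs + 1, by omega, ?_⟩
  intro n N hN hn
  rw [eval_eq_sum_range]
  have h1 : ∑ i ∈ Finset.range (f.natDegree + 1), (f.coeff i * (n : ℤ) ^ i).natAbs ≤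
      (∑ i ∈ Finset.range (f.natDegree + 1), (f.coeff i).natAbs) * N ^ f.natDegree := by
    rw [Finset.sum_mul]
    refine Finset.sum_le_sum fun i hi => ?_
    rw [Int.natAbs_mul, Int.natAbs_pow, Int.natAbs_natCast]
    refine Nat.mul_le_mul_left _ ?_
    calc n ^ i ≤ N ^ i := by gcongr
      _ ≤ N ^ f.natDegree := Nat.pow_le_pow_right hN (by simpa [Nat.lt_succ_iff] using hi)
  refine (Int.natAbs_sum_le _ _).trans (h1.trans ?_)
  gcongr
  omega

theorem eval_ne_zero_of_irreducible {f : ℤ[X]} (hirr : Irreducible f) (hdeg : 2 ≤ f.natDegree)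
    (n : ℤ) : f.eval n ≠ 0 := by
  intro h
  obtain ⟨g, hg⟩ := dvd_iff_isRoot.2 h
  have hg0 : g ≠ 0 := by rintro rfl; rw [mul_zero] at hg; exact hirr.ne_zero hg
  have hdeg' : f.natDegree = 1 + g.natDegree := by
    rw [hg, natDegree_mul (X_sub_C_ne_zero n) hg0, natDegree_X_sub_C]
  rcases hirr.isUnit_or_isUnit hg with hu | hu
  · have := natDegree_eq_zero_of_isUnit hu
    rw [natDegree_X_sub_C] at this
    omega
  · have := natDegree_eq_zero_of_isUnit hu
    omega

/-- The Mertens bound gives the main term. The sum of log p / p² converges, the O(log N) per prime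
adds up to O(N) because π(2N) log N = O(N), and the primes dividing D cost O(N) each. -/
theorem exists_sum_prodExponent_mul_log_le {f : ℤ[X]} (hf : f.Monic) (hirr : Irreducible f)
    (hdeg : 2 ≤ f.natDegree) : ∃ C : ℝ, ∀ N : ℕ, 1 ≤ N →
      ∑ p ∈ (2 * N).primesLE, prodExponent f N p * Real.log p ≤ N * Real.log N + C * N := by
  obtain ⟨D, hD0, u, v, hD⟩ := exists_bezout_derivative hf hirr
  obtain ⟨C₁, hC₁⟩ := exists_sum_rootCount_mul_log_div_le hf hirr
  obtain ⟨C₂, hC₂, hpi⟩ := exists_card_primesLE_mul_log_le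
  obtain ⟨C₃, hC₃, hsq⟩ := exists_sum_log_div_sq_le
  obtain ⟨c, hc0, hc⟩ := exists_natAbs_eval_le f
  have hev : ∀ n : ℤ, f.eval n ≠ 0 := eval_ne_zero_of_irreducible hirr hdeg
  set d := f.natDegree
  have hc1 : (1 : ℝ) ≤ c := by exact_mod_cast Nat.one_le_iff_ne_zero.2 hc0
  have hlogc : 0 ≤ Real.log c := Real.log_nonneg hc1
  have hH : ∀ N : ℕ, 1 ≤ N → Real.log (c * N ^ d : ℕ) = Real.log c + d * Real.log N := by
    intro N hN
    have hN0 : (0 : ℝ) < N := by exact_mod_cast hN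
    push_cast
    rw [Real.log_mul (by positivity) (by positivity), Real.log_pow]
  have hcN : ∀ N : ℕ, 1 ≤ N → c * N ^ d ≠ 0 := fun N hN =>
    mul_ne_zero hc0 (pow_ne_zero _ (by omega))
  have hbad : ∀ p : ℕ, ∃ E : ℝ, 0 ≤ E ∧ (p.Prime → ∀ N : ℕ, 1 ≤ N →
      prodExponent f N p * Real.log p ≤ E * N) := by
    intro p
    by_cases hp : p.Prime
    · obtain ⟨A, hA, hcount⟩ := exists_dvdCount_pow_le hD0 hD hp
      have hlogp : 0 ≤ Real.log p := Real.log_natCast_nonneg p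
      refine ⟨A * (Real.log p / p + 2 * (Real.log p / (p : ℝ) ^ 2) + (Real.log c + d)),
        by positivity, fun _ N hN => ?_⟩
      refine (prodExponent_mul_log_le (H := c * N ^ d) hA hp (fun n _ => hev n) (hcN N hN)
        (fun n hn => hc n N hN (Finset.mem_Icc.1 hn).2) (fun k _ => hcount k N)).trans ?_
      rw [mul_assoc, hH N hN]
      gcongr
      have hN1 : (1 : ℝ) ≤ N := by exact_mod_cast hN
      have h1 : Real.log c ≤ Real.log c * N := le_mul_of_one_le_right hlogc hN1
      have h2 : d * Real.log N ≤ d * N := by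
        gcongr; exact Real.log_le_self (by positivity)
      linarith
    · exact ⟨0, le_rfl, fun h => absurd h hp⟩
  choose E hE0 hE using hbad
  refine ⟨Real.log 2 + C₁ + 2 * d * C₃ + d * (2 * Real.log c + d * (2 * C₂)) +
    ∑ p ∈ D.divisors, E p, fun N hN => ?_⟩
  have hN1 : (1 : ℝ) ≤ N := by exact_mod_cast hN
  have hlogN : 0 ≤ Real.log N := Real.log_nonneg hN1
  have hterm : ∀ p ∈ (2 * N).primesLE, prodExponent f N p * Real.log p ≤
      N * (rootCount f p * (Real.log p / p)) +
      2 * d * N * (Real.log p / (p : ℝ) ^ 2) + d * (Real.log c + d * Real.log N) +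
      (if p ∣ D then E p * N else 0) := by
    intro p hp
    have hp := Nat.prime_of_mem_primesLE hp
    have hlogp : 0 ≤ Real.log p := Real.log_natCast_nonneg p
    split_ifs with hpD
    · have := hE p hp N hN
      refine this.trans (le_add_of_nonneg_left ?_)
      positivity
    · have hrho : (rootCount f p : ℝ) ≤ d := by exact_mod_cast rootCount_le_natDegree hf hp
      refine (prodExponent_mul_log_le (H := c * N ^ d) (Nat.cast_nonneg (rootCount f p)) hp
        (fun n _ => hev n) (hcN N hN) (fun n hn => hc n N hN (Finset.mem_Icc.1 hn).2)
        (fun k hk => dvdCount_pow_le_of_not_dvd hD hp hpD hk N)).trans ?_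
      rw [hH N hN, add_zero]
      have h1 : rootCount f p * (2 * N * (Real.log p / (p : ℝ) ^ 2)) ≤
          d * (2 * N * (Real.log p / (p : ℝ) ^ 2)) := by gcongr
      have h2 : rootCount f p * (Real.log c + d * Real.log N) ≤
          d * (Real.log c + d * Real.log N) := by gcongr
      linarith
  refine (Finset.sum_le_sum hterm).trans ?_
  rw [Finset.sum_add_distrib, Finset.sum_add_distrib, Finset.sum_add_distrib, ← Finset.mul_sum,
    ← Finset.mul_sum, Finset.sum_const, nsmul_eq_mul]
  have h1 := hC₁ (2 * N) (by omega)
  push_cast at h1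
  rw [Real.log_mul (by norm_num) (by positivity)] at h1
  have h2 := hsq (2 * N).primesLE
  have h3 := hpi (2 * N) (by omega)
  push_cast at h3
  have h4 : ((2 * N).primesLE.card : ℝ) ≤ 2 * N := by
    rw [Nat.primesLE_eq_filter_Icc_one]
    have := Finset.card_filter_le (Finset.Icc 1 (2 * N)) Nat.Prime
    rw [Nat.card_Icc, Nat.add_sub_cancel] at this
    exact_mod_cast this
  have h5 : ∑ p ∈ (2 * N).primesLE, (if p ∣ D then E p * N else 0) ≤
      (∑ p ∈ D.divisors, E p) * N := by
    rw [← Finset.sum_filter, Finset.sum_mul]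
    refine Finset.sum_le_sum_of_subset_of_nonneg (fun p hp => ?_)
      fun p _ _ => mul_nonneg (hE0 p) (by positivity)
    exact Nat.mem_divisors.2 ⟨(Finset.mem_filter.1 hp).2, hD0⟩
  have h6 : (2 * N).primesLE.card * (d * (Real.log c + d * Real.log N)) ≤
      d * (2 * Real.log c + d * (2 * C₂)) * N := by
    have h7 : (2 * N).primesLE.card * Real.log N ≤ C₂ * (2 * N) := by
      refine le_trans ?_ h3
      gcongr
      linarith
    calc (2 * N).primesLE.card * (d * (Real.log c + d * Real.log N))
        = d * ((2 * N).primesLE.card * Real.log c +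
          d * ((2 * N).primesLE.card * Real.log N)) := by ring
      _ ≤ d * (2 * N * Real.log c + d * (C₂ * (2 * N))) := by gcongr
      _ = _ := by ring
  have h8 : N * ∑ p ∈ (2 * N).primesLE, rootCount f p * (Real.log p / p) ≤
      N * (Real.log 2 + Real.log N + C₁) := by gcongr
  have h9 : 2 * d * N * ∑ p ∈ (2 * N).primesLE, Real.log p / (p : ℝ) ^ 2 ≤ 2 * d * N * C₃ := by
    gcongr
  linarith

end SmallPrimes

/-! ### Primes above 2N, where evenness enters, and the size of the product -/

section LargePrimes

open Module Polynomial

theorem eval_neg_eq_of_comp_neg_X {f : ℤ[X]} (heven : f.comp (-X) = f) (n : ℤ) :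
    f.eval (-n) = f.eval n := by
  conv_rhs => rw [← heven, eval_comp, eval_neg, eval_X]

theorem two_mul_dvdCount_le_natDegree {f : ℤ[X]} (hf : f.Monic) (heven : f.comp (-X) = f)
    {p N : ℕ} (hp : p.Prime) (hpN : 2 * N < p) : 2 * dvdCount f N p ≤ f.natDegree := by
  classical
  set s := (Finset.Icc 1 N).filter fun n : ℕ => (p : ℤ) ∣ f.eval (n : ℤ) with hs
  have hmem : ∀ n ∈ s, 1 ≤ n ∧ n ≤ N ∧ (p : ℤ) ∣ f.eval (n : ℤ) := fun n hn => by
    obtain ⟨h1, h2⟩ := Finset.mem_filter.1 hn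
    exact ⟨(Finset.mem_Icc.1 h1).1, (Finset.mem_Icc.1 h1).2, h2⟩
  set s₁ := s.image fun n : ℕ => (n : ℤ)
  set s₂ := s.image fun n : ℕ => -(n : ℤ)
  have h₁ : s₁.card = s.card := Finset.card_image_of_injective _ Nat.cast_injective
  have h₂ : s₂.card = s.card := Finset.card_image_of_injective _
    (neg_injective.comp Nat.cast_injective)
  have hspec : ∀ m ∈ s₁ ∪ s₂, |m| ≤ N ∧ (p : ℤ) ∣ f.eval m := by
    intro m hm
    rcases Finset.mem_union.1 hm with h | h <;> obtain ⟨n, hn, rfl⟩ := Finset.mem_image.1 h <;>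
      obtain ⟨-, hle, hdvd⟩ := hmem n hn
    · exact ⟨by simpa using hle, hdvd⟩
    · exact ⟨by simpa using hle, by rwa [eval_neg_eq_of_comp_neg_X heven]⟩
  have hdisj : Disjoint s₁ s₂ := by
    rw [Finset.disjoint_left]
    intro m hm hm'
    obtain ⟨n, hn, rfl⟩ := Finset.mem_image.1 hm
    obtain ⟨n', hn', h⟩ := Finset.mem_image.1 hm'
    have := (hmem n hn).1
    omega
  have hcard := card_le_natDegree_of_dvd_eval hf hp (s₁ ∪ s₂) (fun m hm => (hspec m hm).2) (by
    intro m hm n hn h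
    have h1 := abs_le.1 (hspec m hm).1
    have h2 := abs_le.1 (hspec n hn).1
    have := Int.eq_zero_of_abs_lt_dvd h (by rw [abs_lt]; constructor <;> omega)
    omega)
  rw [Finset.card_union_of_disjoint hdisj, h₁, h₂] at hcard
  change 2 * s.card ≤ _
  omega

theorem log_eq_sum_primesLE {m X : ℕ} (hX : m ≤ X) :
    Real.log m = ∑ p ∈ X.primesLE, m.factorization p * Real.log p := by
  rw [Real.log_nat_eq_sum_factorization]
  refine Finsupp.sum_of_support_subset _ (fun p hp => ?_) _ (by simp)
  rw [Nat.support_factorization] at hp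
  exact Nat.mem_primesLE.2 ⟨(Nat.le_of_mem_primeFactors hp).trans hX,
    Nat.prime_of_mem_primeFactors hp⟩

theorem sum_log_eval_eq {f : ℤ[X]} {N X : ℕ}
    (hX : ∀ n ∈ Finset.Icc 1 N, (f.eval (n : ℤ)).natAbs ≤ X) :
    ∑ n ∈ Finset.Icc 1 N, Real.log (f.eval (n : ℤ)).natAbs =
      ∑ p ∈ X.primesLE, prodExponent f N p * Real.log p := by
  simp only [prodExponent, Nat.cast_sum, Finset.sum_mul]
  rw [Finset.sum_comm]
  exact Finset.sum_congr rfl fun n hn =>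
    log_eq_sum_primesLE (hX n hn)

/-- Each value divisible by p contributes at most the exponent of p in L, the others nothing. -/
theorem prodExponent_le_dvdCount_mul {f : ℤ[X]} {N L p : ℕ} (hL : L ≠ 0)
    (hdvd : ∀ n ∈ Finset.Icc 1 N, (f.eval (n : ℤ)).natAbs ∣ L) :
    prodExponent f N p ≤ dvdCount f N p * L.factorization p := by
  rw [prodExponent, dvdCount, Finset.card_filter, Finset.sum_mul]
  refine Finset.sum_le_sum fun n hn => ?_
  have hle : (f.eval (n : ℤ)).natAbs.factorization p ≤ L.factorization p :=
    (Nat.factorization_le_iff_dvd (ne_zero_of_dvd_ne_zero hL (hdvd n hn)) hL).2 (hdvd n hn) p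
  split_ifs with h
  · rwa [one_mul]
  · rw [zero_mul, Nat.factorization_eq_zero_of_not_dvd]
    rwa [← Int.natCast_dvd]

theorem sum_log_eval_le {f : ℤ[X]} (hf : f.Monic) (heven : f.comp (-X) = f)
    {N L : ℕ} (hL : L ≠ 0)
    (hdvd : ∀ n ∈ Finset.Icc 1 N, (f.eval (n : ℤ)).natAbs ∣ L) :
    ∑ n ∈ Finset.Icc 1 N, Real.log (f.eval (n : ℤ)).natAbs ≤
      ∑ p ∈ (2 * N).primesLE, prodExponent f N p * Real.log p +
        f.natDegree / 2 * Real.log L := by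
  have hnn : ∀ p : ℕ, 0 ≤ Real.log p := fun p => Real.log_natCast_nonneg p
  rw [sum_log_eval_eq fun n hn => Nat.le_of_dvd (Nat.pos_of_ne_zero hL) (hdvd n hn),
    log_eq_sum_primesLE le_rfl, Finset.mul_sum,
    ← Finset.sum_filter_add_sum_filter_not L.primesLE (· ≤ 2 * N)]
  refine add_le_add ?_ ?_
  · refine Finset.sum_le_sum_of_subset_of_nonneg (fun p hp => ?_)
      fun p _ _ => mul_nonneg (Nat.cast_nonneg _) (hnn p)
    obtain ⟨h1, h2⟩ := Finset.mem_filter.1 hp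
    exact Nat.mem_primesLE.2 ⟨h2, Nat.prime_of_mem_primesLE h1⟩
  · refine (Finset.sum_le_sum fun p hp => ?_).trans
      (Finset.sum_le_sum_of_subset_of_nonneg (Finset.filter_subset _ _) fun p _ _ =>
        mul_nonneg (by positivity) (mul_nonneg (Nat.cast_nonneg _) (hnn p)))
    obtain ⟨h1, h2⟩ := Finset.mem_filter.1 hp
    have h3 : (2 * dvdCount f N p : ℝ) ≤ f.natDegree := by
      exact_mod_cast two_mul_dvdCount_le_natDegree hf heven (Nat.prime_of_mem_primesLE h1)
        (not_le.1 h2)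
    have h4 : (prodExponent f N p : ℝ) ≤ dvdCount f N p * L.factorization p := by
      exact_mod_cast prodExponent_le_dvdCount_mul hL hdvd
    rw [← mul_assoc]
    refine mul_le_mul_of_nonneg_right (h4.trans ?_) (hnn p)
    gcongr
    linarith

theorem exists_le_sum_log_eval {f : ℤ[X]} (hf : f.Monic) (h0 : ∀ n : ℤ, f.eval n ≠ 0) :
    ∃ C : ℝ, ∀ N : ℕ, 1 ≤ N → f.natDegree * (N * Real.log N) - C * N ≤
      ∑ n ∈ Finset.Icc 1 N, Real.log (f.eval (n : ℤ)).natAbs := by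
  set d := f.natDegree
  have hO : (fun n : ℕ => (n : ℝ) ^ d) =O[Filter.atTop]
      fun n : ℕ => ((f.eval (n : ℤ) : ℤ) : ℝ) := by
    have h := (isEquivalent_atTop_lead (f.map (Int.castRingHom ℝ))).isBigO_symm.comp_tendsto
      (tendsto_natCast_atTop_atTop (R := ℝ))
    refine h.congr (fun n => ?_) (fun n => ?_)
    · simp [(hf.map (Int.castRingHom ℝ)).leadingCoeff, hf.natDegree_map, d]
    · simp
  -- As f has no integer zero, the asymptotic bound holds at every n after enlarging the constant.
  obtain ⟨c, hc, hbound⟩ := Asymptotics.bound_of_isBigO_nat_atTop hO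
  refine ⟨Real.log c + d, fun N hN => ?_⟩
  have hterm : ∀ n ∈ Finset.Icc 1 N, d * Real.log n - Real.log c ≤
      Real.log (f.eval (n : ℤ)).natAbs := by
    intro n hn
    have hn0 : (0 : ℝ) < n := by exact_mod_cast (Finset.mem_Icc.1 hn).1
    have h1 := hbound (x := n) (Int.cast_ne_zero.2 (h0 n))
    rw [Real.norm_of_nonneg (by positivity), Real.norm_eq_abs, ← Int.cast_abs,
      ← Nat.cast_natAbs] at h1
    have h2 := Real.log_le_log (by positivity) h1
    have h3 : ((f.eval (n : ℤ)).natAbs : ℝ) ≠ 0 :=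
      Nat.cast_ne_zero.2 (Int.natAbs_ne_zero.2 (h0 n))
    rw [Real.log_pow, Real.log_mul hc.ne' h3] at h2
    linarith
  refine le_trans ?_ (Finset.sum_le_sum hterm)
  rw [Finset.sum_sub_distrib, ← Finset.mul_sum, Finset.sum_const, Nat.card_Icc,
    Nat.add_sub_cancel, nsmul_eq_mul]
  have hN0 : (0 : ℝ) < N := by exact_mod_cast hN
  have hfact : ∑ n ∈ Finset.Icc 1 N, Real.log n = Real.log N.factorial := by
    clear hN hN0 hterm
    induction N with
    | zero => simp
    | succ N ih =>
      rw [Finset.sum_Icc_succ_top (by omega), ih, Nat.factorial_succ, Nat.cast_mul,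
        Real.log_mul (by positivity) (by positivity), add_comm]
  -- Weak Stirling: N^N / N! is one term of the series for e^N.
  have hstir : N * Real.log N - N ≤ Real.log N.factorial := by
    have h := Real.pow_div_factorial_le_exp N hN0.le N
    have h1 := Real.log_le_log (by positivity) h
    rw [Real.log_div (by positivity) (by positivity), Real.log_pow, Real.log_exp] at h1
    linarith
  rw [hfact]
  have := mul_le_mul_of_nonneg_left hstir (Nat.cast_nonneg (α := ℝ) d)
  linarith

end LargePrimes

/-! ### Conclusion -/

theorem mainTheorem1 (f : Polynomial ℤ) (hmonic : f.Monic) (hirr : Irreducible f)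
    (hdeg : 2 ≤ f.natDegree) (heven : f.comp (-Polynomial.X) = f) :
    ∃ C : ℝ, ∀ N : ℕ, 1 ≤ N →
      2 * ((f.natDegree : ℝ) - 1) / (f.natDegree : ℝ) * ((N : ℝ) * Real.log (N : ℝ))
          - C * (N : ℝ)
        ≤ Real.log (polyLcm f N : ℝ) := by
  have h0 : ∀ n : ℤ, f.eval n ≠ 0 := eval_ne_zero_of_irreducible hirr hdeg
  obtain ⟨C₁, hC₁⟩ := exists_sum_prodExponent_mul_log_le hmonic hirr hdeg
  obtain ⟨C₂, hC₂⟩ := exists_le_sum_log_eval hmonic h0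
  have hd : (0 : ℝ) < f.natDegree := by exact_mod_cast (by omega : 0 < f.natDegree)
  refine ⟨2 / f.natDegree * (C₁ + C₂), fun N hN => ?_⟩
  have hL : (polyLcm f N).natAbs ≠ 0 := by
    rw [Int.natAbs_ne_zero, polyLcm, Ne, Finset.lcm_eq_zero_iff]
    rintro ⟨n, -, hn⟩
    exact h0 n hn
  have h1 := sum_log_eval_le hmonic heven hL
    (fun n hn => Int.natAbs_dvd_natAbs.2 (Finset.dvd_lcm (f := fun n : ℕ => f.eval (n : ℤ)) hn))
  have hlog : Real.log ((polyLcm f N).natAbs : ℝ) = Real.log (polyLcm f N : ℝ) := by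
    rw [Nat.cast_natAbs, Int.cast_abs, Real.log_abs]
  rw [hlog] at h1
  have h2 := hC₁ N hN
  have h3 := hC₂ N hN
  -- The small primes remove one N log N out of d; multiplying by 2/d then isolates log L.
  have h4 : (f.natDegree - 1 : ℝ) * (N * Real.log N) - (C₁ + C₂) * N ≤
      f.natDegree / 2 * Real.log (polyLcm f N : ℝ) := by linarith
  have h5 := mul_le_mul_of_nonneg_left h4 (by positivity : (0 : ℝ) ≤ 2 / f.natDegree)
  refine (le_of_eq ?_).trans (h5.trans (le_of_eq ?_))
  · field_simp
  · field_simp
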